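/- Let $(\xi_k)_{k\in\mathbb Z}$ be identically distributed real random variables on a probability space that form a sequence of martingale differences adapted to a filtration $(\mathcal F_k)_{k\in\mathbb Z}$: each $\xi_k$ is $\mathcal F_k$-measurable and integrable, and $\mathbb E(\xi_k\mid\mathcal F_{k-1})=0$ a.s. Put $H_0(x)=\mathbb E\big(\xi_0^2 I(|\xi_0|\le x)\big)$ and assume that $\mathbb E(\xi_0^2)=\infty$ and that (DA) $H_0$ is slowly varying at $\infty$, i.e. $H_0(tx)/H_0(x)\to1$ as $x\to\infty$ for every $t>0$. Let $b=\inf\{x\ge 0: H_0(x)>1\}$, $H(x)=H_0(\max(x,b+1))$ (so that $H\ge 1$, and $H=H_0$ on $[b+1,\infty)$), and $$D_n=\inf\Big\{s\ge1:\ \frac{n}{s^2}H(s)\le 1\Big\},\qquad M_n=\sum_{k=1}^n\xi_k .$$ (i) If $$\frac1{D_n^2}\sum_{k=1}^n\xi_k^2\to 1\quad\text{in probability as } n\to\infty, \tag{$*$}$$ then $M_n/D_n$ converges in distribution to the standard normal law $N(0,1)$ as $n\to\infty$. (ii) Condition $(*)$ holds if one of the following two conditions is satisfied: ($M_1$) there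 is a sequence of positive numbers $\psi_k\to0$ such that for all $a,b>0$, all integers $j$ and all integers $k\ge1$, $$\operatorname{cov}\big(\xi_j^2I(|\xi_j|\le a),\,\xi_{j+k}^2I(|\xi_{j+k}|\le b)\big)\le\psi_k\,\mathbb E\big(\xi_0^2I(|\xi_0|\le b)\big)\,\mathbb E\big(\xi_0^2I(|\xi_0|\le a)\big);$$ ($M_2$) there is a sequence of positive numbers $\varphi_k$ with $\sum_{k\ge1}\varphi_k<\infty$ such that for all $a,b>0$, all integers $j$ and all integers $k\ge1$, $$\operatorname{cov}\big(\xi_j^2I(|\xi_j|\le a),\,\xi_{j+k}^2I(|\xi_{j+k}|\le b)\big)\le a^2\varphi_k\,\mathbb E\big(\xi_0^2I(|\xi_0|\le b)\big).$$ -/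

import Mathlib

open MeasureTheory ProbabilityTheory Filter Topology

namespace InfVarMart

/-- `f` is slowly varying at infinity. -/
def SlowlyVarying (f : ℝ → ℝ) : Prop :=
  Measurable f ∧ (∀ᶠ x in atTop, 0 < f x) ∧
    ∀ t : ℝ, 0 < t → Tendsto (fun x => f (t * x) / f x) atTop (𝓝 1)

/-- The truncated square `X² I(|X| ≤ a)`. -/
noncomputable def truncSq {Ω : Type*} (X : Ω → ℝ) (a : ℝ) : Ω → ℝ :=
  Set.indicator {ω | |X ω| ≤ a} (fun ω => X ω ^ 2)

/-- The truncated second moment `E (X² I(|X| ≤ x))`, as a function of `x`. -/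
noncomputable def truncMoment {Ω : Type*} [MeasurableSpace Ω] (μ : Measure Ω) (X : Ω → ℝ)
    (x : ℝ) : ℝ :=
  ∫ ω, truncSq X x ω ∂μ

/-- `(ξ_k)` is a sequence of martingale differences adapted to the filtration `ℱ`. -/
structure IsMartingaleDifference {Ω : Type*} {m : MeasurableSpace Ω} (μ : Measure Ω)
    (ℱ : Filtration ℤ m) (ξ : ℤ → Ω → ℝ) : Prop where
  adapted : Adapted ℱ ξ
  integrable : ∀ k, Integrable (ξ k) μ
  condExp_eq_zero : ∀ k, μ[ξ k | ℱ (k - 1)] =ᵐ[μ] 0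

/-- The level `b = inf {x ≥ 0 : E (X² I(|X| ≤ x)) > 1}`. -/
noncomputable def cutLevel {Ω : Type*} [MeasurableSpace Ω] (μ : Measure Ω) (X : Ω → ℝ) : ℝ :=
  sInf {x : ℝ | 0 ≤ x ∧ 1 < truncMoment μ X x}

/-- The modified truncated second moment `H (x) = E (X² I(|X| ≤ max x (b + 1)))`. -/
noncomputable def modMoment {Ω : Type*} [MeasurableSpace Ω] (μ : Measure Ω) (X : Ω → ℝ)
    (x : ℝ) : ℝ :=
  truncMoment μ X (max x (cutLevel μ X + 1))

/-- The normalizer `D_n = inf {s ≥ 1 : (n / s²) H (s) ≤ 1}`. -/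
noncomputable def normalizer {Ω : Type*} [MeasurableSpace Ω] (μ : Measure Ω) (X : Ω → ℝ)
    (n : ℕ) : ℝ :=
  sInf {s : ℝ | 1 ≤ s ∧ (n : ℝ) / s ^ 2 * modMoment μ X s ≤ 1}

/-- The pairwise mixing condition `(M₁)`. -/
def MixingOne {Ω : Type*} [MeasurableSpace Ω] (μ : Measure Ω) (ξ : ℤ → Ω → ℝ) : Prop :=
  ∃ ψ : ℕ → ℝ, (∀ k, 0 < ψ k) ∧ Tendsto ψ atTop (𝓝 0) ∧
    ∀ a b : ℝ, 0 < a → 0 < b → ∀ (j : ℤ) (k : ℕ), 1 ≤ k →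
      cov[truncSq (ξ j) a, truncSq (ξ (j + k)) b; μ] ≤
        ψ k * truncMoment μ (ξ 0) b * truncMoment μ (ξ 0) a

/-- The pairwise mixing condition `(M₂)`. -/
def MixingTwo {Ω : Type*} [MeasurableSpace Ω] (μ : Measure Ω) (ξ : ℤ → Ω → ℝ) : Prop :=
  ∃ φ : ℕ → ℝ, (∀ k, 0 < φ k) ∧ Summable φ ∧
    ∀ a b : ℝ, 0 < a → 0 < b → ∀ (j : ℤ) (k : ℕ), 1 ≤ k →
      cov[truncSq (ξ j) a, truncSq (ξ (j + k)) b; μ] ≤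
        a ^ 2 * φ k * truncMoment μ (ξ 0) b

/-- `D_n⁻² ∑_{k=1}^n ξ_k²` converges to `1` in probability. -/
def SquaresConverge {Ω : Type*} [MeasurableSpace Ω] (μ : Measure Ω) (ξ : ℤ → Ω → ℝ) : Prop :=
  TendstoInMeasure μ
    (fun (n : ℕ) ω => 1 / normalizer μ (ξ 0) n ^ 2 * ∑ k ∈ Finset.Icc (1 : ℤ) n, ξ k ω ^ 2)
    atTop (fun _ => (1 : ℝ))

end InfVarMart

/-!
Part (i) is McLeish's martingale central limit theorem. From `log (1 + i x) = i x + x² / 2 + r` with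
`|r| ≤ |x|³`, the exponential `exp (i ∑ x_k)` is close to `∏ (1 + i x_k) * exp (-v / 2)` as soon as
`∑ x_k²` is close to `v` and all `x_k` are small. For martingale differences, the product stopped
once `∑ x_k²` exceeds `v + 1` has mean `1` and is bounded by a multiple of `1 + max |x_k|`, so the
characteristic function of `∑ x_k` is close to `exp (-v / 2)`. For `x_k = ξ_k / D_n` the maximum is
small in `L¹` because of Karamata's relation `x E (|ξ₀| I(|ξ₀| > x)) = o (H₀ x)` and
`n H (D_n) = D_n²`.

In part (ii) the squares are truncated at the level `θ D_n`. This changes the sum with probability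
at most `n P (|ξ₀| > θ D_n) → 0`, and the mixing conditions bound the variance of the normalized
truncated sum by `O (θ²) + o (1)`, so that Chebyshev's inequality applies.
-/

namespace InfVarMart

section PathwiseEstimates

lemma norm_one_add_mul_I_le_exp (x : ℝ) :
    ‖(1 + x * Complex.I : ℂ)‖ ≤ Real.exp (x ^ 2 / 2) := by
  have hnorm : ‖(1 + x * Complex.I : ℂ)‖ = √(1 + x ^ 2) := by
    simpa only [Complex.ofReal_one, one_pow] using Complex.norm_add_mul_I 1 x
  rw [hnorm, Real.exp_half]
  exact Real.sqrt_le_sqrt (by linarith [Real.add_one_le_exp (x ^ 2)])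

lemma norm_log_one_add_mul_I_sub_le {x : ℝ} (hx : |x| ≤ 1 / 2) :
    ‖Complex.log (1 + x * Complex.I) - (x * Complex.I + x ^ 2 / 2)‖ ≤ |x| * x ^ 2 := by
  have hnorm : ‖(x * Complex.I : ℂ)‖ = |x| := by simp
  have htaylor : Complex.logTaylor 3 (x * Complex.I) = x * Complex.I + x ^ 2 / 2 := by
    simp [Complex.logTaylor_succ, Complex.logTaylor_zero, mul_pow]
    ring
  have hinv : (1 - |x|)⁻¹ ≤ 2 := by
    rw [inv_le_comm₀ (by linarith) two_pos]
    linarith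
  have hlog := Complex.norm_log_sub_logTaylor_le 2 (z := x * Complex.I) (by rw [hnorm]; linarith)
  rw [htaylor, hnorm] at hlog
  calc _ ≤ |x| ^ 3 * (1 - |x|)⁻¹ / 3 := by exact_mod_cast hlog
    _ ≤ |x| ^ 3 * 2 / 3 := by gcongr
    _ ≤ |x| ^ 3 := by linarith [pow_nonneg (abs_nonneg x) 3]
    _ = |x| * x ^ 2 := by rw [← sq_abs x]; ring

/- Writing `log (1 + i x) = i x + x² / 2 + r`, the product equals `exp (i ∑ x + V / 2 + ∑ r)`
with `V = ∑ x²` and `|∑ r| ≤ η V`. -/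
lemma norm_exp_sum_mul_I_sub_prod_mul_exp_le {κ : Type*} {s : Finset κ} {x : κ → ℝ} {v η : ℝ}
    (hη : η ≤ 1 / 2) (hx : ∀ k ∈ s, |x k| ≤ η)
    (hsmall : 2 * η * ∑ k ∈ s, x k ^ 2 + |∑ k ∈ s, x k ^ 2 - v| ≤ 2) :
    ‖Complex.exp ((∑ k ∈ s, x k : ℝ) * Complex.I) -
        (∏ k ∈ s, (1 + x k * Complex.I)) * Real.exp (-v / 2)‖ ≤
      2 * η * ∑ k ∈ s, x k ^ 2 + |∑ k ∈ s, x k ^ 2 - v| := by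
  set V := ∑ k ∈ s, x k ^ 2 with hV
  let r : κ → ℂ := fun k => Complex.log (1 + x k * Complex.I) - (x k * Complex.I + x k ^ 2 / 2)
  let w : ℂ := ∑ k ∈ s, r k + ((V - v) / 2 : ℝ)
  have hr : ‖∑ k ∈ s, r k‖ ≤ η * V := by
    rw [hV, Finset.mul_sum]
    refine norm_sum_le_of_le s fun k hk => ?_
    refine (norm_log_one_add_mul_I_sub_le ((hx k hk).trans hη)).trans ?_
    gcongr
    exact hx k hk
  have hw : ‖w‖ ≤ η * V + |V - v| / 2 := by
    refine (norm_add_le _ _).trans (add_le_add hr ?_)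
    rw [Complex.norm_real, Real.norm_eq_abs, abs_div, abs_two]
  have hfactor (k : κ) :
      1 + x k * Complex.I = Complex.exp (x k * Complex.I + x k ^ 2 / 2 + r k) := by
    rw [add_sub_cancel, Complex.exp_log]
    intro h
    simpa using congrArg Complex.re h
  have hprod : (∏ k ∈ s, (1 + x k * Complex.I)) * Real.exp (-v / 2) =
      Complex.exp ((∑ k ∈ s, x k : ℝ) * Complex.I) * Complex.exp w := by
    rw [Finset.prod_congr rfl fun k _ => hfactor k, ← Complex.exp_sum, Complex.ofReal_exp,
      ← Complex.exp_add, ← Complex.exp_add]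
    congr 1
    simp only [w, hV, Finset.sum_add_distrib, ← Finset.sum_mul, ← Finset.sum_div]
    push_cast
    ring
  calc _ = ‖Complex.exp w - 1‖ := by
        rw [hprod, ← mul_one_sub, norm_mul, Complex.norm_exp_ofReal_mul_I, one_mul, norm_sub_rev]
    _ ≤ 2 * ‖w‖ := Complex.norm_exp_sub_one_le (by linarith)
    _ ≤ 2 * η * V + |V - v| := by linarith

/-- McLeish's stopped product: the product `∏ (1 + i x_k)` over `k < n`, whose factors are
replaced by `1` as soon as the preceding partial sum of squares exceeds `c`. -/
noncomputable def stoppedProd (c : ℝ) (x : ℕ → ℝ) (n : ℕ) : ℂ :=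
  ∏ k ∈ Finset.range n,
    (1 + ((if ∑ j ∈ Finset.range k, x j ^ 2 ≤ c then x k else 0 : ℝ) : ℂ) * Complex.I)

lemma stoppedProd_eq_prod {c : ℝ} {x : ℕ → ℝ} {n : ℕ}
    (h : ∑ j ∈ Finset.range n, x j ^ 2 ≤ c) :
    stoppedProd c x n = ∏ k ∈ Finset.range n, (1 + x k * Complex.I) := by
  refine Finset.prod_congr rfl fun k hk => ?_
  rw [if_pos]
  refine le_trans ?_ h
  exact Finset.sum_le_sum_of_subset_of_nonneg
    (Finset.range_subset_range.2 (Finset.mem_range.1 hk).le) fun _ _ _ => sq_nonneg _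

lemma stoppedProd_succ (c : ℝ) (x : ℕ → ℝ) (n : ℕ) :
    stoppedProd c x (n + 1) = stoppedProd c x n +
      x n • (if ∑ j ∈ Finset.range n, x j ^ 2 ≤ c then stoppedProd c x n * Complex.I else 0) := by
  rw [stoppedProd, Finset.prod_range_succ, ← stoppedProd, Complex.real_smul]
  split_ifs <;> push_cast <;> ring

lemma norm_stoppedProd_le_of_sum_le {c : ℝ} {x : ℕ → ℝ} {n : ℕ}
    (h : ∑ j ∈ Finset.range n, x j ^ 2 ≤ c) : ‖stoppedProd c x n‖ ≤ Real.exp (c / 2) := by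
  rw [stoppedProd_eq_prod h, norm_prod]
  calc _ ≤ ∏ k ∈ Finset.range n, Real.exp (x k ^ 2 / 2) := by
        gcongr
        exact norm_one_add_mul_I_le_exp _
    _ = Real.exp ((∑ j ∈ Finset.range n, x j ^ 2) / 2) := by
        rw [← Real.exp_sum, ← Finset.sum_div]
    _ ≤ Real.exp (c / 2) := by gcongr

/- At most one factor is not controlled by the budget `c`: the one at which the partial sum of
squares crosses it. -/
lemma norm_stoppedProd_le {c M : ℝ} (hc : 0 ≤ c) (hM : 0 ≤ M) {x : ℕ → ℝ} {n : ℕ}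
    (hx : ∀ k < n, |x k| ≤ M) : ‖stoppedProd c x n‖ ≤ Real.exp (c / 2) * (1 + M) := by
  induction n with
  | zero =>
    have hexp : 1 ≤ Real.exp (c / 2) := Real.one_le_exp (by positivity)
    simpa [stoppedProd] using one_le_mul_of_one_le_of_one_le hexp (le_add_of_nonneg_right hM)
  | succ n ih =>
    rw [stoppedProd_succ]
    split_ifs with hsum
    · have hbound := norm_stoppedProd_le_of_sum_le hsum
      calc _ ≤ ‖stoppedProd c x n‖ + |x n| * ‖stoppedProd c x n‖ := by
              refine (norm_add_le _ _).trans_eq ?_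
              rw [norm_smul, norm_mul, Complex.norm_I, mul_one, Real.norm_eq_abs]
        _ ≤ Real.exp (c / 2) + M * Real.exp (c / 2) := by
              gcongr
              exact hx n n.lt_succ_self
        _ = Real.exp (c / 2) * (1 + M) := by ring
    · simpa only [smul_zero, add_zero] using ih fun k hk => hx k (hk.trans n.lt_succ_self)

lemma norm_exp_sum_mul_I_sub_stoppedProd_mul_exp_le_of_abs_le {c v M : ℝ} (hc : 0 ≤ c)
    (hv : 0 ≤ v) (hM : 0 ≤ M) {x : ℕ → ℝ} {n : ℕ} (hx : ∀ k < n, |x k| ≤ M) :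
    ‖Complex.exp ((∑ k ∈ Finset.range n, x k : ℝ) * Complex.I) -
        stoppedProd c x n * Real.exp (-v / 2)‖ ≤ 1 + Real.exp (c / 2) * (1 + M) := by
  refine (norm_sub_le _ _).trans (add_le_add (Complex.norm_exp_ofReal_mul_I _).le ?_)
  rw [norm_mul, Complex.norm_real, Real.norm_of_nonneg (Real.exp_nonneg _)]
  exact (mul_le_of_le_one_right (norm_nonneg _) (Real.exp_le_one_iff.2 (by linarith))).trans
    (norm_stoppedProd_le hc hM hx)

/- The last two summands are at least `1` unless `∑ x²` is within `η` of `v` and every `|x k|` is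
at most `η`. -/
lemma norm_exp_sum_mul_I_sub_stoppedProd_mul_exp_le {v η M : ℝ} {x : ℕ → ℝ} {n : ℕ}
    (hv : 0 ≤ v) (hη : 0 < η) (hηv : η * (v + 1) ≤ 1 / 2) (hM : 0 ≤ M)
    (hx : ∀ k < n, |x k| ≤ M) :
    ‖Complex.exp ((∑ k ∈ Finset.range n, x k : ℝ) * Complex.I) -
        stoppedProd (v + 1) x n * Real.exp (-v / 2)‖ ≤
      3 * Real.exp (v + 1) *
        (η + (if η ≤ |∑ k ∈ Finset.range n, x k ^ 2 - v| then 1 else 0) + M / η) := by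
  have hη' : η ≤ 1 / 2 := by nlinarith
  set V := ∑ k ∈ Finset.range n, x k ^ 2
  set bad : ℝ := (if η ≤ |V - v| then 1 else 0) + M / η with hbad
  have hbad0 : 0 ≤ bad := add_nonneg (by split_ifs <;> norm_num) (by positivity)
  have hexp : v + 1 + 1 ≤ Real.exp (v + 1) := Real.add_one_le_exp _
  rw [add_assoc, ← hbad]
  by_cases hgood : |V - v| < η ∧ M ≤ η
  · obtain ⟨hVv, hMη⟩ := hgood
    have hVc : V ≤ v + 1 := by linarith [(abs_lt.1 hVv).2]
    have hηV : η * V ≤ η * (v + 1) := by gcongr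
    rw [stoppedProd_eq_prod hVc]
    calc _ ≤ 2 * η * V + |V - v| := norm_exp_sum_mul_I_sub_prod_mul_exp_le hη'
            (fun k hk => (hx k (Finset.mem_range.1 hk)).trans hMη) (by linarith)
      _ ≤ (2 * (v + 1) + 1) * η := by linarith
      _ ≤ 3 * Real.exp (v + 1) * (η + bad) := by
          gcongr
          · linarith
          · linarith
  · have hbad1 : 1 ≤ bad := by
      rcases not_and_or.1 hgood with hVv | hMη
      · rw [hbad, if_pos (not_lt.1 hVv)]
        linarith [show 0 ≤ M / η by positivity]
      · have : 1 ≤ M / η := (one_le_div hη).2 (not_le.1 hMη).le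
        rw [hbad]
        split_ifs <;> linarith
    have hMbad : M ≤ bad := by
      have : M ≤ M / η := le_div_self hM hη (by linarith)
      rw [hbad]
      split_ifs <;> linarith
    have hhalf : Real.exp ((v + 1) / 2) ≤ Real.exp (v + 1) := by gcongr; linarith
    calc _ ≤ 1 + Real.exp ((v + 1) / 2) * (1 + M) :=
          norm_exp_sum_mul_I_sub_stoppedProd_mul_exp_le_of_abs_le (by linarith) hv hM hx
      _ ≤ Real.exp (v + 1) * bad + Real.exp (v + 1) * (bad + bad) := by
          have : 1 * 1 ≤ Real.exp (v + 1) * bad := by gcongr; linarith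
          gcongr
          linarith
      _ ≤ 3 * Real.exp (v + 1) * (η + bad) := by nlinarith [Real.exp_pos (v + 1)]

end PathwiseEstimates

section TruncatedMoments

variable {Ω : Type*} {X : Ω → ℝ}

lemma truncSq_apply (X : Ω → ℝ) (a : ℝ) (ω : Ω) :
    truncSq X a ω = if |X ω| ≤ a then X ω ^ 2 else 0 := by
  classical
  rw [truncSq, Set.indicator_apply]
  rfl

lemma truncSq_nonneg (X : Ω → ℝ) (a : ℝ) (ω : Ω) : 0 ≤ truncSq X a ω :=
  Set.indicator_nonneg (fun _ _ => sq_nonneg _) ω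

lemma truncSq_le_sq (X : Ω → ℝ) (a : ℝ) (ω : Ω) : truncSq X a ω ≤ a ^ 2 := by
  rw [truncSq_apply]
  split_ifs with h
  · exact sq_le_sq.2 (h.trans (le_abs_self a))
  · positivity

lemma monotone_truncSq (X : Ω → ℝ) : Monotone (truncSq X) := fun _ _ hab ω =>
  Set.indicator_le_indicator_of_subset (fun _ => le_trans' hab) (fun _ => sq_nonneg _) ω

lemma measurable_ite_abs_le (a : ℝ) : Measurable fun x : ℝ => if |x| ≤ a then x ^ 2 else 0 :=
  Measurable.ite (measurableSet_le measurable_id.abs measurable_const)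
    (measurable_id.pow_const 2) measurable_const

lemma measurable_ite_lt_abs (a : ℝ) : Measurable fun x : ℝ => if a < |x| then |x| else 0 :=
  Measurable.ite (measurableSet_lt measurable_const measurable_id.abs) measurable_id.abs
    measurable_const

variable {m : MeasurableSpace Ω} {μ : Measure Ω}

/-- The first absolute moment `E (|X| I(|X| > a))` of the part of `X` exceeding the level `a`. -/
noncomputable def tailMoment (μ : Measure Ω) (X : Ω → ℝ) (a : ℝ) : ℝ :=
  ∫ ω, (if a < |X ω| then |X ω| else 0) ∂μ

section IdentDistrib

variable {Ω' : Type*} {m' : MeasurableSpace Ω'} {ν : Measure Ω'} {Y : Ω' → ℝ}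

lemma truncMoment_eq_of_identDistrib (h : IdentDistrib X Y μ ν) :
    truncMoment μ X = truncMoment ν Y := by
  ext a
  simpa only [truncMoment, truncSq_apply, Function.comp_def] using
    (h.comp (measurable_ite_abs_le a)).integral_eq

lemma tailMoment_eq_of_identDistrib (h : IdentDistrib X Y μ ν) :
    tailMoment μ X = tailMoment ν Y := by
  ext a
  exact (h.comp (measurable_ite_lt_abs a)).integral_eq

end IdentDistrib

lemma truncMoment_nonneg (X : Ω → ℝ) (a : ℝ) : 0 ≤ truncMoment μ X a :=
  integral_nonneg (truncSq_nonneg X a)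

lemma tailMoment_nonneg (X : Ω → ℝ) (a : ℝ) : 0 ≤ tailMoment μ X a :=
  integral_nonneg fun ω => by dsimp only [Pi.zero_apply]; split_ifs <;> positivity

lemma integrable_ite_lt_abs (hX : Integrable X μ) (a : ℝ) :
    Integrable (fun ω => if a < |X ω| then |X ω| else 0) μ := by
  refine hX.abs.mono ((measurable_ite_lt_abs a).comp_aemeasurable hX.aemeasurable
    ).aestronglyMeasurable (.of_forall fun ω => ?_)
  split_ifs <;> simp

lemma tailMoment_const_mul (X : Ω → ℝ) {r : ℝ} (hr : r ≠ 0) (a : ℝ) :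
    tailMoment μ (fun ω => r * X ω) a = |r| * tailMoment μ X (a / |r|) := by
  simp only [tailMoment, ← integral_const_mul, abs_mul, mul_ite, mul_zero,
    div_lt_iff₀' (abs_pos.2 hr)]

lemma tendsto_tailMoment_zero (hX : Integrable X μ) :
    Tendsto (tailMoment μ X) atTop (𝓝 0) := by
  rw [← integral_zero Ω ℝ (μ := μ)]
  refine tendsto_integral_filter_of_dominated_convergence (fun ω => |X ω|)
    (.of_forall fun a => (integrable_ite_lt_abs hX a).aestronglyMeasurable)
    (.of_forall fun a => .of_forall fun ω => ?_) hX.abs (.of_forall fun ω => ?_)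
  · split_ifs <;> simp
  · refine tendsto_const_nhds.congr' ?_
    filter_upwards [eventually_ge_atTop |X ω|] with a ha
    rw [if_neg (not_lt.2 ha)]

lemma mul_measureReal_lt_abs_le_tailMoment [IsFiniteMeasure μ] (hX : Integrable X μ) {a : ℝ}
    (ha : 0 ≤ a) : a * μ.real {ω | a < |X ω|} ≤ tailMoment μ X a := by
  refine le_trans ?_ (mul_meas_ge_le_integral_of_nonneg
    (.of_forall fun ω => ?_) (integrable_ite_lt_abs hX a) a)
  · refine mul_le_mul_of_nonneg_left (measureReal_mono fun ω (hω : a < |X ω|) => ?_) ha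
    exact hω.le.trans_eq (if_pos hω).symm
  · dsimp only [Pi.zero_apply]
    split_ifs <;> positivity

variable [IsFiniteMeasure μ]

lemma memLp_truncSq (hX : AEMeasurable X μ) (a : ℝ) (p : ENNReal) : MemLp (truncSq X a) p μ := by
  refine MemLp.of_bound (C := a ^ 2) ?_ (.of_forall fun ω => ?_)
  · simpa only [Function.comp_def, ← truncSq_apply] using
      ((measurable_ite_abs_le a).comp_aemeasurable hX).aestronglyMeasurable
  · rw [Real.norm_of_nonneg (truncSq_nonneg X a ω)]
    exact truncSq_le_sq X a ω

lemma integrable_truncSq (hX : AEMeasurable X μ) (a : ℝ) : Integrable (truncSq X a) μ :=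
  (memLp_truncSq hX a 1).integrable le_rfl

lemma monotone_truncMoment (hX : AEMeasurable X μ) : Monotone (truncMoment μ X) := fun _ _ hab =>
  integral_mono (integrable_truncSq hX _) (integrable_truncSq hX _) (monotone_truncSq X hab)

lemma truncMoment_le_mul_integral_abs (hX : Integrable X μ) {a : ℝ} (ha : 0 ≤ a) :
    truncMoment μ X a ≤ a * ∫ ω, |X ω| ∂μ := by
  rw [← integral_const_mul]
  refine integral_mono (integrable_truncSq hX.aemeasurable a) (hX.abs.const_mul a) fun ω => ?_
  simp only [truncSq_apply]
  split_ifs with h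
  · rw [← sq_abs, sq]
    gcongr
  · positivity

lemma tendsto_truncMoment_atTop (hX : AEMeasurable X μ)
    (hinf : ∫⁻ ω, ENNReal.ofReal (X ω ^ 2) ∂μ = ⊤) :
    Tendsto (truncMoment μ X) atTop atTop := by
  refine tendsto_atTop_atTop_of_monotone (monotone_truncMoment hX) fun b => ?_
  by_contra! hbounded
  have hlim : Tendsto (fun n : ℕ => ∫⁻ ω, ENNReal.ofReal (truncSq X n ω) ∂μ) atTop
      (𝓝 (∫⁻ ω, ENNReal.ofReal (X ω ^ 2) ∂μ)) := by
    refine lintegral_tendsto_of_tendsto_of_monotone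
      (fun n => (integrable_truncSq hX n).aemeasurable.ennreal_ofReal) (.of_forall fun ω => ?_)
      (.of_forall fun ω => tendsto_const_nhds.congr' ?_)
    · exact fun a c hac => ENNReal.ofReal_le_ofReal (monotone_truncSq X (Nat.cast_le.2 hac) ω)
    · filter_upwards [eventually_ge_atTop ⌈|X ω|⌉₊] with n hn
      rw [truncSq_apply, if_pos (Nat.ceil_le.1 hn)]
  have htop : (⊤ : ENNReal) ≤ ENNReal.ofReal b := by
    rw [hinf] at hlim
    refine le_of_tendsto' hlim fun n => ?_
    rw [← ofReal_integral_eq_lintegral_ofReal (integrable_truncSq hX n)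
      (.of_forall (truncSq_nonneg X n))]
    exact ENNReal.ofReal_le_ofReal (hbounded n).le
  exact ENNReal.ofReal_ne_top (top_le_iff.1 htop)

/- For `x < |X| ≤ 2x` one has `|X| ≤ X² / x`. -/
lemma tailMoment_le_tailMoment_two_mul_add (hX : Integrable X μ) {x : ℝ} (hx : 0 < x) :
    tailMoment μ X x ≤
      tailMoment μ X (2 * x) + (truncMoment μ X (2 * x) - truncMoment μ X x) / x := by
  have htrunc := integrable_truncSq hX.aemeasurable
  have hdiff : Integrable (fun ω => (truncSq X (2 * x) ω - truncSq X x ω) / x) μ :=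
    ((htrunc (2 * x)).sub (htrunc x)).div_const x
  rw [truncMoment, truncMoment, ← integral_sub (htrunc _) (htrunc _), ← integral_div, tailMoment,
    tailMoment, ← integral_add (integrable_ite_lt_abs hX _) hdiff]
  refine integral_mono (integrable_ite_lt_abs hX _) ((integrable_ite_lt_abs hX _).add hdiff)
    fun ω => ?_
  simp only [truncSq_apply]
  rcases le_or_gt |X ω| x with hle | hlt
  · have hle' : |X ω| ≤ 2 * x := by linarith
    simp only [hle, hle', not_lt.2 hle, not_lt.2 hle', if_true, if_false, sub_self, zero_div,
      add_zero, le_refl]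
  · simp only [hlt, not_le.2 hlt, if_true, if_false, sub_zero]
    rcases le_or_gt |X ω| (2 * x) with hle' | hlt'
    · rw [if_neg (not_lt.2 hle'), if_pos hle', zero_add, le_div_iff₀ hx, ← sq_abs, sq]
      gcongr
    · rw [if_pos hlt', if_neg (not_le.2 hlt'), zero_div, add_zero]

end TruncatedMoments

section Karamata

lemma nonpos_of_le_two_mul {G T : ℝ → ℝ} {x : ℝ} (hx : 0 < x)
    (hG : ∀ y, x ≤ y → G y ≤ G (2 * y)) (hGT : ∀ y, x ≤ y → G y ≤ T y)
    (hT : Tendsto T atTop (𝓝 0)) : G x ≤ 0 := by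
  have hle (N : ℕ) : x ≤ 2 ^ N * x := le_mul_of_one_le_left hx.le (one_le_pow₀ one_le_two)
  have hchain (N : ℕ) : G x ≤ G (2 ^ N * x) := by
    induction N with
    | zero => rw [pow_zero, one_mul]
    | succ N ih =>
      rw [pow_succ', mul_assoc]
      exact ih.trans (hG _ (hle N))
  have hlim : Tendsto (fun N : ℕ => T (2 ^ N * x)) atTop (𝓝 0) :=
    hT.comp ((tendsto_pow_atTop_atTop_of_one_lt one_lt_two).atTop_mul_const hx)
  exact ge_of_tendsto' hlim fun N => (hchain N).trans (hGT _ (hle N))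

/- For `ε > 0` the function `x ↦ T x - ε H x / x` eventually does not decrease under doubling, and
it is at most `T x`, which tends to `0`. -/
lemma tendsto_mul_div_zero_of_le_two_mul {H T : ℝ → ℝ} (hHpos : ∀ᶠ x in atTop, 0 < H x)
    (hH : Tendsto (fun x => H (2 * x) / H x) atTop (𝓝 1)) (hTnonneg : ∀ x, 0 ≤ T x)
    (hT : Tendsto T atTop (𝓝 0))
    (hstep : ∀ x, 0 < x → T x ≤ T (2 * x) + (H (2 * x) - H x) / x) :
    Tendsto (fun x => x * T x / H x) atTop (𝓝 0) := by
  have hbound (ε : ℝ) (hε : 0 < ε) : ∀ᶠ x in atTop, x * T x ≤ ε * H x := by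
    have hratio : 1 < (1 + ε) / (1 + ε / 2) := (one_lt_div (by positivity)).2 (by linarith)
    obtain ⟨x₀, hx₀⟩ := eventually_atTop.1 (hHpos.and (hH.eventually_le_const hratio))
    filter_upwards [eventually_ge_atTop x₀, eventually_gt_atTop 0] with x hx hxpos
    have hdouble (y : ℝ) (hy : x ≤ y) :
        T y - ε * H y / y ≤ T (2 * y) - ε * H (2 * y) / (2 * y) := by
      have hy0 : 0 < y := hxpos.trans_le hy
      obtain ⟨hHy, hle⟩ := hx₀ y (hx.trans hy)
      rw [div_le_div_iff₀ hHy (by positivity)] at hle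
      have hcompare : (H (2 * y) - H y) / y - ε * H y / y ≤ -(ε * H (2 * y) / (2 * y)) := by
        rw [← sub_div, ← neg_div, div_le_div_iff₀ hy0 (by positivity)]
        nlinarith
      linarith [hstep y hy0]
    have hle (y : ℝ) (hy : x ≤ y) : T y - ε * H y / y ≤ T y :=
      sub_le_self _ (div_nonneg (mul_nonneg hε.le (hx₀ y (hx.trans hy)).1.le)
        (hxpos.le.trans hy))
    have hTx := nonpos_of_le_two_mul (G := fun y => T y - ε * H y / y) hxpos hdouble hle hT
    rwa [sub_nonpos, le_div_iff₀' hxpos] at hTx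
  refine tendsto_order.2 ⟨fun a ha => ?_, fun a ha => ?_⟩
  · filter_upwards [hHpos, eventually_gt_atTop 0] with x hHx hx
    exact ha.trans_le (div_nonneg (mul_nonneg hx.le (hTnonneg x)) hHx.le)
  · filter_upwards [hHpos, hbound (a / 2) (half_pos ha)] with x hHx hx
    rw [div_lt_iff₀ hHx]
    nlinarith

lemma tendsto_mul_tailMoment_div_truncMoment {Ω : Type*} [MeasurableSpace Ω] {μ : Measure Ω}
    [IsFiniteMeasure μ] {X : Ω → ℝ} (hX : Integrable X μ)
    (hDA : SlowlyVarying (truncMoment μ X)) :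
    Tendsto (fun x => x * tailMoment μ X x / truncMoment μ X x) atTop (𝓝 0) :=
  tendsto_mul_div_zero_of_le_two_mul hDA.2.1 (hDA.2.2 2 two_pos) (tailMoment_nonneg X)
    (tendsto_tailMoment_zero hX) fun _ => tailMoment_le_tailMoment_two_mul_add hX

end Karamata

section McLeish

variable {Ω : Type*} {m : MeasurableSpace Ω} {μ : Measure Ω}

lemma integral_smul_eq_zero_of_condExp_eq_zero {E : Type*} [NormedAddCommGroup E]
    [NormedSpace ℝ E] [CompleteSpace E] {m' : MeasurableSpace Ω} (hm' : m' ≤ m)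
    [SigmaFinite (μ.trim hm')] {f : Ω → ℝ} {g : Ω → E} (hf : Integrable f μ)
    (hfg : Integrable (f • g) μ) (hg : AEStronglyMeasurable[m'] g μ)
    (hcond : μ[f | m'] =ᵐ[μ] 0) : ∫ ω, (f • g) ω ∂μ = 0 := by
  rw [← integral_condExp hm']
  refine integral_eq_zero_of_ae ?_
  filter_upwards [condExp_smul_of_aestronglyMeasurable_right hf hfg hg, hcond] with ω hpull hzero
  rw [hpull, Pi.smul_apply', hzero, Pi.zero_apply, zero_smul, Pi.zero_apply]

lemma tendstoInMeasure_const_mul {ι : Type*} {l : Filter ι} {f : ι → Ω → ℝ} {g : Ω → ℝ}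
    (h : TendstoInMeasure μ f l g) (r : ℝ) :
    TendstoInMeasure μ (fun i ω => r * f i ω) l (fun ω => r * g ω) := by
  rw [tendstoInMeasure_iff_norm] at h ⊢
  intro ε hε
  rcases eq_or_ne r 0 with rfl | hr
  · simpa [hε.not_ge] using tendsto_const_nhds
  · simpa only [← mul_sub, norm_mul, div_le_iff₀' (norm_pos_iff.2 hr)] using
      h (ε / ‖r‖) (by positivity)

lemma sum_Icc_one_eq_sum_range {E : Type*} [AddCommMonoid E] (f : ℤ → E) (n : ℕ) :
    ∑ k ∈ Finset.Icc (1 : ℤ) n, f k = ∑ k ∈ Finset.range n, f (k + 1) := by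
  refine (Finset.sum_bij (fun (k : ℕ) _ => (k + 1 : ℤ)) ?_ ?_ ?_ fun _ _ => rfl).symm
  · intro k hk
    simp only [Finset.mem_range, Finset.mem_Icc] at hk ⊢
    lia
  · exact fun _ _ _ _ h => by simpa using h
  · intro k hk
    simp only [Finset.mem_Icc] at hk
    exact ⟨(k - 1).toNat, by simp only [Finset.mem_range]; lia, by lia⟩

lemma abs_le_add_sum_ite_lt_abs {κ : Type*} {s : Finset κ} (x : κ → ℝ) {a : ℝ} (ha : 0 ≤ a)
    {k : κ} (hk : k ∈ s) : |x k| ≤ a + ∑ j ∈ s, if a < |x j| then |x j| else 0 := by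
  have hnonneg (j : κ) : 0 ≤ if a < |x j| then |x j| else 0 := by split_ifs <;> positivity
  rcases le_or_gt |x k| a with hle | hlt
  · exact hle.trans (le_add_of_nonneg_right (Finset.sum_nonneg fun j _ => hnonneg j))
  · calc |x k| = if a < |x k| then |x k| else 0 := (if_pos hlt).symm
      _ ≤ ∑ j ∈ s, if a < |x j| then |x j| else 0 :=
          Finset.single_le_sum (fun j _ => hnonneg j) hk
      _ ≤ _ := le_add_of_nonneg_left ha

namespace IsMartingaleDifference

variable {ℱ : Filtration ℤ m} {X : ℤ → Ω → ℝ}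

lemma measurable (hX : IsMartingaleDifference μ ℱ X) (k : ℤ) : Measurable (X k) :=
  (hX.adapted k).mono (ℱ.le k) le_rfl

lemma const_mul (hX : IsMartingaleDifference μ ℱ X) (r : ℝ) :
    IsMartingaleDifference μ ℱ fun k ω => r * X k ω where
  adapted k := (hX.adapted k).const_mul r
  integrable k := (hX.integrable k).const_mul r
  condExp_eq_zero k := by
    refine (condExp_smul r (X k) (ℱ (k - 1))).trans ?_
    filter_upwards [hX.condExp_eq_zero k] with ω hω
    rw [Pi.smul_apply, hω, Pi.zero_apply, smul_zero]

lemma measurable_of_le (hX : IsMartingaleDifference μ ℱ X) {j k : ℤ} (hjk : j ≤ k) :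
    Measurable[ℱ k] (X j) :=
  (hX.adapted j).mono (ℱ.mono hjk) le_rfl

lemma measurable_sum_sq (hX : IsMartingaleDifference μ ℱ X) {k n : ℕ} (hkn : k ≤ n) :
    Measurable[ℱ n] fun ω => ∑ j ∈ Finset.range k, X (j + 1) ω ^ 2 :=
  Finset.measurable_fun_sum _ fun j hj =>
    (hX.measurable_of_le (by have := Finset.mem_range.1 hj; lia)).pow_const 2

lemma measurable_stoppedProd (hX : IsMartingaleDifference μ ℱ X) (c : ℝ) (n : ℕ) :
    Measurable[ℱ n] fun ω => stoppedProd c (fun k => X (k + 1) ω) n := by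
  refine Finset.measurable_fun_prod _ fun k hk => ?_
  have hkn : k < n := Finset.mem_range.1 hk
  have hfactor : Measurable[ℱ n]
      fun ω => if ∑ j ∈ Finset.range k, X (j + 1) ω ^ 2 ≤ c then X (k + 1) ω else 0 :=
    Measurable.ite (measurableSet_le (hX.measurable_sum_sq hkn.le) measurable_const)
      (hX.measurable_of_le (by lia)) measurable_const
  exact measurable_const.add ((Complex.measurable_ofReal.comp hfactor).mul measurable_const)

lemma integrable_stoppedProd [IsFiniteMeasure μ] (hX : IsMartingaleDifference μ ℱ X) {c : ℝ}
    (hc : 0 ≤ c) (n : ℕ) : Integrable (fun ω => stoppedProd c (fun k => X (k + 1) ω) n) μ := by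
  have hsum : Integrable (fun ω => 1 + ∑ k ∈ Finset.range n, |X (k + 1) ω|) μ :=
    (integrable_const 1).add (integrable_finsetSum _ fun k _ => (hX.integrable (k + 1)).abs)
  refine (hsum.const_mul (Real.exp (c / 2))).mono'
    ((hX.measurable_stoppedProd c n).mono (ℱ.le n) le_rfl).aestronglyMeasurable
    (.of_forall fun ω => norm_stoppedProd_le hc (by positivity) fun k hk => ?_)
  exact Finset.single_le_sum (f := fun k : ℕ => |X (k + 1) ω|) (fun _ _ => abs_nonneg _)
    (Finset.mem_range.2 hk)

lemma integral_stoppedProd [IsProbabilityMeasure μ] (hX : IsMartingaleDifference μ ℱ X) {c : ℝ}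
    (hc : 0 ≤ c) (n : ℕ) : ∫ ω, stoppedProd c (fun k => X (k + 1) ω) n ∂μ = 1 := by
  induction n with
  | zero => simp [stoppedProd]
  | succ n ih =>
    let g : Ω → ℂ := fun ω => if ∑ j ∈ Finset.range n, X (j + 1) ω ^ 2 ≤ c then
      stoppedProd c (fun k => X (k + 1) ω) n * Complex.I else 0
    have hg : Measurable[ℱ n] g :=
      Measurable.ite (measurableSet_le (hX.measurable_sum_sq le_rfl) measurable_const)
        ((hX.measurable_stoppedProd c n).mul measurable_const) measurable_const
    have hsucc (ω : Ω) : stoppedProd c (fun k => X (k + 1) ω) (n + 1) =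
        stoppedProd c (fun k => X (k + 1) ω) n + (X (n + 1) • g) ω :=
      stoppedProd_succ c _ n
    have hint := hX.integrable_stoppedProd hc
    have hincrement : Integrable (X (n + 1) • g) μ :=
      ((hint (n + 1)).sub (hint n)).congr
        (.of_forall fun ω => sub_eq_of_eq_add' (hsucc ω))
    have hcond : μ[X (n + 1) | ℱ n] =ᵐ[μ] 0 := by
      simpa only [add_sub_cancel_right] using hX.condExp_eq_zero (n + 1)
    simp only [hsucc]
    rw [integral_add (hint n) hincrement, ih, integral_smul_eq_zero_of_condExp_eq_zero (ℱ.le n)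
      (hX.integrable _) hincrement hg.stronglyMeasurable.aestronglyMeasurable hcond, add_zero]

lemma norm_integral_exp_sum_mul_I_sub_le [IsProbabilityMeasure μ]
    (hX : IsMartingaleDifference μ ℱ X) {n : ℕ} {v η : ℝ} {M : Ω → ℝ} (hv : 0 ≤ v) (hη : 0 < η)
    (hηv : η * (v + 1) ≤ 1 / 2) (hM : Integrable M μ) (hM0 : ∀ ω, 0 ≤ M ω)
    (hXM : ∀ ω, ∀ k < n, |X (k + 1) ω| ≤ M ω) :
    ‖∫ ω, Complex.exp ((∑ k ∈ Finset.range n, X (k + 1) ω : ℝ) * Complex.I) ∂μ -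
        Real.exp (-v / 2)‖ ≤
      3 * Real.exp (v + 1) *
        (η + μ.real {ω | η ≤ |∑ k ∈ Finset.range n, X (k + 1) ω ^ 2 - v|} +
          (∫ ω, M ω ∂μ) / η) := by
  set B : Set Ω := {ω | η ≤ |∑ k ∈ Finset.range n, X (k + 1) ω ^ 2 - v|} with hB
  have hBmeas : MeasurableSet B := measurableSet_le measurable_const
    (((hX.measurable_sum_sq le_rfl).mono (ℱ.le n) le_rfl).sub_const v).abs
  have hsum : Measurable fun ω => ∑ k ∈ Finset.range n, X (k + 1) ω :=
    Finset.measurable_fun_sum _ fun k _ => hX.measurable _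
  have hexp : Integrable
      (fun ω => Complex.exp ((∑ k ∈ Finset.range n, X (k + 1) ω : ℝ) * Complex.I)) μ :=
    .of_bound (C := 1) ((Complex.measurable_exp.comp
      ((Complex.measurable_ofReal.comp hsum).mul_const _)).aestronglyMeasurable)
      (.of_forall fun ω => (Complex.norm_exp_ofReal_mul_I _).le)
  have hprod := hX.integrable_stoppedProd (c := v + 1) (by linarith) n
  have hBint : Integrable (B.indicator fun _ => (1 : ℝ)) μ := (integrable_const 1).indicator hBmeas
  have hηB : Integrable (fun ω => η + B.indicator (fun _ => 1) ω) μ :=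
    (integrable_const η).add hBint
  calc _ = ‖∫ ω, (Complex.exp ((∑ k ∈ Finset.range n, X (k + 1) ω : ℝ) * Complex.I) -
          stoppedProd (v + 1) (fun k => X (k + 1) ω) n * Real.exp (-v / 2)) ∂μ‖ := by
        rw [integral_sub hexp (hprod.mul_const _), integral_mul_const,
          hX.integral_stoppedProd (by linarith), one_mul]
    _ ≤ ∫ ω, 3 * Real.exp (v + 1) * (η + B.indicator (fun _ => 1) ω + M ω / η) ∂μ := by
        refine norm_integral_le_of_norm_le ((hηB.add (hM.div_const η)).const_mul _)
          (.of_forall fun ω => ?_)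
        simpa only [Set.indicator_apply, hB, Set.mem_ofPred_eq] using
          norm_exp_sum_mul_I_sub_stoppedProd_mul_exp_le hv hη hηv (hM0 ω) (hXM ω)
    _ = _ := by
        rw [integral_const_mul, integral_add hηB (hM.div_const η),
          integral_add (integrable_const η) hBint, integral_div, integral_indicator_const _ hBmeas,
          integral_const, probReal_univ, one_smul, smul_eq_mul, mul_one]

lemma norm_integral_exp_sum_mul_I_sub_le_sum_tailMoment [IsProbabilityMeasure μ]
    (hX : IsMartingaleDifference μ ℱ X) (n : ℕ) {v η a : ℝ} (hv : 0 ≤ v) (hη : 0 < η)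
    (hηv : η * (v + 1) ≤ 1 / 2) (ha : 0 ≤ a) :
    ‖∫ ω, Complex.exp ((∑ k ∈ Finset.range n, X (k + 1) ω : ℝ) * Complex.I) ∂μ -
        Real.exp (-v / 2)‖ ≤
      3 * Real.exp (v + 1) *
        (η + μ.real {ω | η ≤ |∑ k ∈ Finset.range n, X (k + 1) ω ^ 2 - v|} +
          (a + ∑ k ∈ Finset.range n, tailMoment μ (X (k + 1)) a) / η) := by
  let tail : ℕ → Ω → ℝ := fun k ω => if a < |X (k + 1) ω| then |X (k + 1) ω| else 0
  have htail (k : ℕ) : Integrable (tail k) μ := integrable_ite_lt_abs (hX.integrable _) _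
  have htail_nonneg (k : ℕ) (ω : Ω) : 0 ≤ tail k ω := by
    dsimp only [tail]
    split_ifs <;> positivity
  have hsum : Integrable (fun ω => ∑ k ∈ Finset.range n, tail k ω) μ :=
    integrable_finsetSum _ fun k _ => htail k
  have hbound := hX.norm_integral_exp_sum_mul_I_sub_le (n := n) hv hη hηv
    (M := fun ω => a + ∑ k ∈ Finset.range n, tail k ω) ((integrable_const _).add hsum)
    (fun ω => add_nonneg ha (Finset.sum_nonneg fun k _ => htail_nonneg k ω))
    (fun ω k hk => abs_le_add_sum_ite_lt_abs (fun k : ℕ => X (k + 1) ω) ha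
      (Finset.mem_range.2 hk))
  rwa [integral_add (integrable_const _) hsum, integral_finsetSum _ fun k _ => htail k,
    integral_const, probReal_univ, one_smul] at hbound

end IsMartingaleDifference

section Arrays

variable [IsProbabilityMeasure μ] {ℱ : ℕ → Filtration ℤ m} {X : ℕ → ℤ → Ω → ℝ} {N : ℕ → ℕ}

lemma tendsto_integral_exp_sum_mul_I (hX : ∀ n, IsMartingaleDifference μ (ℱ n) (X n))
    (htail : ∀ a, 0 < a → Tendsto
      (fun n => ∑ k ∈ Finset.Icc (1 : ℤ) (N n), tailMoment μ (X n k) a) atTop (𝓝 0))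
    {v : ℝ} (hv : 0 ≤ v) (hsq : TendstoInMeasure μ
      (fun n ω => ∑ k ∈ Finset.Icc (1 : ℤ) (N n), X n k ω ^ 2) atTop (fun _ => v)) :
    Tendsto (fun n => ∫ ω, Complex.exp
      ((∑ k ∈ Finset.Icc (1 : ℤ) (N n), X n k ω : ℝ) * Complex.I) ∂μ)
      atTop (𝓝 (Real.exp (-v / 2) : ℂ)) := by
  rw [Metric.tendsto_nhds]
  intro γ hγ
  set K := 3 * Real.exp (v + 1)
  obtain ⟨η, hη, hηv, hηγ⟩ : ∃ η > 0, η * (v + 1) ≤ 1 / 2 ∧ K * (2 * η) < γ := by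
    refine ⟨min (1 / 2 / (v + 1)) (γ / (4 * K)), by positivity, ?_, ?_⟩
    · rw [← le_div_iff₀ (by linarith)]
      exact min_le_left _ _
    · have := min_le_right (1 / 2 / (v + 1)) (γ / (4 * K))
      rw [le_div_iff₀ (by positivity)] at this
      linarith
  let R : ℕ → ℝ := fun n => ∑ k ∈ Finset.Icc (1 : ℤ) (N n), tailMoment μ (X n k) (η ^ 2)
  let p : ℕ → ℝ := fun n => μ.real {ω | η ≤ ‖∑ k ∈ Finset.Icc (1 : ℤ) (N n), X n k ω ^ 2 - v‖}
  have hlim : Tendsto (fun n => K * (η + p n + (η ^ 2 + R n) / η)) atTop (𝓝 (K * (2 * η))) := by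
    have hp : Tendsto p atTop (𝓝 0) := tendstoInMeasure_iff_measureReal_norm.1 hsq η hη
    have hR : Tendsto R atTop (𝓝 0) := htail (η ^ 2) (by positivity)
    have hsq_div : η ^ 2 / η = η := by field_simp
    have h := ((hp.const_add η).add ((hR.const_add (η ^ 2)).div_const η)).const_mul K
    rwa [add_zero, add_zero, hsq_div, ← two_mul] at h
  filter_upwards [hlim.eventually_lt_const hηγ] with n hn
  refine lt_of_le_of_lt ?_ hn
  simpa only [dist_eq_norm, R, p, K, sum_Icc_one_eq_sum_range, Real.norm_eq_abs] using
    (hX n).norm_integral_exp_sum_mul_I_sub_le_sum_tailMoment (N n) hv hη hηv (sq_nonneg η)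

theorem tendstoInDistribution_gaussianReal_of_tendsto_sum_tailMoment
    (hX : ∀ n, IsMartingaleDifference μ (ℱ n) (X n))
    (htail : ∀ a, 0 < a → Tendsto
      (fun n => ∑ k ∈ Finset.Icc (1 : ℤ) (N n), tailMoment μ (X n k) a) atTop (𝓝 0))
    {v : NNReal} (hsq : TendstoInMeasure μ
      (fun n ω => ∑ k ∈ Finset.Icc (1 : ℤ) (N n), X n k ω ^ 2) atTop (fun _ => (v : ℝ))) :
    TendstoInDistribution (fun n ω => ∑ k ∈ Finset.Icc (1 : ℤ) (N n), X n k ω)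
      atTop (id : ℝ → ℝ) (fun _ => μ) (gaussianReal 0 v) := by
  have hmeas (n : ℕ) : Measurable fun ω => ∑ k ∈ Finset.Icc (1 : ℤ) (N n), X n k ω :=
    Finset.measurable_fun_sum _ fun k _ => (hX n).measurable k
  refine ⟨fun n => (hmeas n).aemeasurable, aemeasurable_id, ?_⟩
  refine ProbabilityMeasure.tendsto_iff_tendsto_charFun.2 fun t => ?_
  have htail_scaled (a : ℝ) (ha : 0 < a) : Tendsto (fun n => ∑ k ∈ Finset.Icc (1 : ℤ) (N n),
      tailMoment μ (fun ω => t * X n k ω) a) atTop (𝓝 0) := by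
    rcases eq_or_ne t 0 with rfl | ht
    · simp [tailMoment, ha.not_gt]
    · simpa only [tailMoment_const_mul _ ht, ← Finset.mul_sum, mul_zero] using
        (htail (a / |t|) (by positivity)).const_mul |t|
  have hsq_scaled : TendstoInMeasure μ (fun n ω => ∑ k ∈ Finset.Icc (1 : ℤ) (N n),
      (t * X n k ω) ^ 2) atTop (fun _ => t ^ 2 * v) := by
    simpa only [mul_pow, ← Finset.mul_sum] using tendstoInMeasure_const_mul hsq (t ^ 2)
  have hexp := tendsto_integral_exp_sum_mul_I (fun n => (hX n).const_mul t) htail_scaled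
    (by positivity) hsq_scaled
  simp only [ProbabilityMeasure.coe_mk, Measure.map_id, charFun_gaussianReal]
  convert hexp using 2 with n
  · rw [charFun_apply_real, integral_map (hmeas n).aemeasurable (by fun_prop)]
    simp only [← Finset.mul_sum, Complex.ofReal_mul]
  · push_cast
    congr 1
    ring

end Arrays

end McLeish

section Normalizer

lemma apply_sInf_le_of_monotone_of_continuous {f g : ℝ → ℝ} (hf : Monotone f) (hg : Continuous g)
    {a : ℝ} (hne : {s | a ≤ s ∧ f s ≤ g s}.Nonempty) :
    f (sInf {s | a ≤ s ∧ f s ≤ g s}) ≤ g (sInf {s | a ≤ s ∧ f s ≤ g s}) := by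
  have hbdd : BddBelow {s | a ≤ s ∧ f s ≤ g s} := ⟨a, fun _ hs => hs.1⟩
  exact closure_minimal (fun s hs => (hf (csInf_le hbdd hs)).trans hs.2)
    (isClosed_le continuous_const hg) (csInf_mem_closure hne hbdd)

lemma le_apply_sInf_of_monotone_of_continuous {f g : ℝ → ℝ} (hf : Monotone f) (hg : Continuous g)
    {a : ℝ} (ha : a < sInf {s | a ≤ s ∧ f s ≤ g s}) :
    g (sInf {s | a ≤ s ∧ f s ≤ g s}) ≤ f (sInf {s | a ≤ s ∧ f s ≤ g s}) := by
  have hlim : Tendsto g (𝓝[<] sInf {s | a ≤ s ∧ f s ≤ g s}) (𝓝 (g (sInf _))) :=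
    hg.continuousWithinAt
  refine le_of_tendsto hlim ?_
  filter_upwards [Ioo_mem_nhdsLT ha] with s ⟨has, hs⟩
  have hlt : g s < f s := by
    by_contra! hle
    exact notMem_of_lt_csInf hs ⟨a, fun _ h => h.1⟩ ⟨has.le, hle⟩
  exact hlt.le.trans (hf hs.le)

variable {Ω : Type*} {m : MeasurableSpace Ω} {μ : Measure Ω} {X : Ω → ℝ}

lemma normalizer_eq_sInf (X : Ω → ℝ) (n : ℕ) :
    normalizer μ X n = sInf {s : ℝ | 1 ≤ s ∧ n * modMoment μ X s ≤ s ^ 2} := by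
  refine congrArg sInf (Set.ext fun s => and_congr_right fun hs => ?_)
  rw [div_mul_eq_mul_div, div_le_one (by positivity)]

variable [IsFiniteMeasure μ]

lemma monotone_modMoment (hX : AEMeasurable X μ) : Monotone (modMoment μ X) := fun _ _ hab =>
  monotone_truncMoment hX (max_le_max_right _ hab)

lemma one_le_modMoment (hX : AEMeasurable X μ) (hinf : ∫⁻ ω, ENNReal.ofReal (X ω ^ 2) ∂μ = ⊤)
    (s : ℝ) : 1 ≤ modMoment μ X s := by
  obtain ⟨y, hy⟩ := ((eventually_ge_atTop 0).and
    ((tendsto_truncMoment_atTop hX hinf).eventually_gt_atTop 1)).exists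
  obtain ⟨x, hx, hxlt⟩ := exists_lt_of_csInf_lt ⟨y, hy⟩ (lt_add_one (cutLevel μ X))
  exact hx.2.le.trans (monotone_truncMoment hX (hxlt.le.trans (le_max_right _ _)))

lemma exists_one_le_and_mul_modMoment_le_sq (hX : Integrable X μ) (n : ℕ) :
    ∃ s, 1 ≤ s ∧ n * modMoment μ X s ≤ s ^ 2 := by
  set E := ∫ ω, |X ω| ∂μ
  obtain ⟨s, hs1, hcut, hnE⟩ : ∃ s : ℝ, 1 ≤ s ∧ cutLevel μ X + 1 ≤ s ∧ n * E ≤ s :=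
    ((eventually_ge_atTop 1).and ((eventually_ge_atTop _).and (eventually_ge_atTop _))).exists
  refine ⟨s, hs1, ?_⟩
  calc n * modMoment μ X s = n * truncMoment μ X s := by rw [modMoment, max_eq_left hcut]
    _ ≤ n * (s * E) := by
        gcongr
        exact truncMoment_le_mul_integral_abs hX (zero_le_one.trans hs1)
    _ = s * (n * E) := by ring
    _ ≤ s * s := by gcongr
    _ = s ^ 2 := (sq s).symm

lemma one_le_normalizer (hX : Integrable X μ) (n : ℕ) : 1 ≤ normalizer μ X n := by
  rw [normalizer_eq_sInf]
  exact le_csInf (exists_one_le_and_mul_modMoment_le_sq hX n) fun _ hs => hs.1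

lemma normalizer_pos (hX : Integrable X μ) (n : ℕ) : 0 < normalizer μ X n :=
  zero_lt_one.trans_le (one_le_normalizer hX n)

lemma mul_modMoment_normalizer_le (hX : Integrable X μ) (n : ℕ) :
    n * modMoment μ X (normalizer μ X n) ≤ normalizer μ X n ^ 2 := by
  rw [normalizer_eq_sInf]
  exact apply_sInf_le_of_monotone_of_continuous
    ((monotone_modMoment hX.aemeasurable).const_mul n.cast_nonneg) (continuous_pow 2)
    (exists_one_le_and_mul_modMoment_le_sq hX n)

lemma natCast_le_normalizer_sq (hX : Integrable X μ)
    (hinf : ∫⁻ ω, ENNReal.ofReal (X ω ^ 2) ∂μ = ⊤) (n : ℕ) : n ≤ normalizer μ X n ^ 2 :=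
  (le_mul_of_one_le_right n.cast_nonneg (one_le_modMoment hX.aemeasurable hinf _)).trans
    (mul_modMoment_normalizer_le hX n)

lemma tendsto_normalizer_atTop (hX : Integrable X μ)
    (hinf : ∫⁻ ω, ENNReal.ofReal (X ω ^ 2) ∂μ = ⊤) : Tendsto (normalizer μ X) atTop atTop :=
  tendsto_atTop_mono
    (fun n => Real.sqrt_le_iff.2 ⟨(normalizer_pos hX n).le, natCast_le_normalizer_sq hX hinf n⟩)
    (Real.tendsto_sqrt_atTop.comp tendsto_natCast_atTop_atTop)

lemma mul_modMoment_normalizer (hX : Integrable X μ)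
    (hinf : ∫⁻ ω, ENNReal.ofReal (X ω ^ 2) ∂μ = ⊤) {n : ℕ} (hn : 2 ≤ n) :
    n * modMoment μ X (normalizer μ X n) = normalizer μ X n ^ 2 := by
  have hlt : 1 < normalizer μ X n := by
    have hn2 : (2 : ℝ) ≤ n := by exact_mod_cast hn
    have hsq := natCast_le_normalizer_sq hX hinf n
    exact lt_of_pow_lt_pow_left₀ 2 (normalizer_pos hX n).le (by linarith)
  refine (mul_modMoment_normalizer_le hX n).antisymm ?_
  rw [normalizer_eq_sInf] at hlt ⊢
  exact le_apply_sInf_of_monotone_of_continuous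
    ((monotone_modMoment hX.aemeasurable).const_mul n.cast_nonneg) (continuous_pow 2) hlt

lemma tendsto_mul_truncMoment_div_normalizer_sq (hX : Integrable X μ)
    (hinf : ∫⁻ ω, ENNReal.ofReal (X ω ^ 2) ∂μ = ⊤) (hDA : SlowlyVarying (truncMoment μ X))
    {c : ℝ} (hc : 0 < c) : Tendsto
      (fun n : ℕ => n * truncMoment μ X (c * normalizer μ X n) / normalizer μ X n ^ 2)
      atTop (𝓝 1) := by
  have hD := tendsto_normalizer_atTop hX hinf
  refine ((hDA.2.2 c hc).comp hD).congr' ?_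
  filter_upwards [eventually_ge_atTop 2, hD.eventually_ge_atTop (cutLevel μ X + 1)] with n hn hcut
  have hn0 : (n : ℝ) ≠ 0 := by positivity
  rw [← mul_modMoment_normalizer hX hinf hn, modMoment, max_eq_left hcut,
    mul_div_mul_left _ _ hn0, Function.comp_apply]

lemma tendsto_mul_tailMoment_div_normalizer (hX : Integrable X μ)
    (hinf : ∫⁻ ω, ENNReal.ofReal (X ω ^ 2) ∂μ = ⊤) (hDA : SlowlyVarying (truncMoment μ X))
    {c : ℝ} (hc : 0 < c) : Tendsto
      (fun n : ℕ => n * tailMoment μ X (c * normalizer μ X n) / normalizer μ X n)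
      atTop (𝓝 0) := by
  have hcD : Tendsto (fun n => c * normalizer μ X n) atTop atTop :=
    (tendsto_normalizer_atTop hX hinf).const_mul_atTop hc
  have hlim := (((tendsto_mul_tailMoment_div_truncMoment hX hDA).comp hcD).mul
    (tendsto_mul_truncMoment_div_normalizer_sq hX hinf hDA hc)).div_const c
  rw [zero_mul, zero_div] at hlim
  refine hlim.congr' ?_
  filter_upwards [hcD.eventually hDA.2.1] with n hpos
  have hD := normalizer_pos hX n
  rw [Function.comp_apply]
  field_simp

lemma tendsto_mul_measureReal_lt_abs (hX : Integrable X μ)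
    (hinf : ∫⁻ ω, ENNReal.ofReal (X ω ^ 2) ∂μ = ⊤) (hDA : SlowlyVarying (truncMoment μ X))
    {c : ℝ} (hc : 0 < c) : Tendsto
      (fun n : ℕ => n * μ.real {ω | c * normalizer μ X n < |X ω|}) atTop (𝓝 0) := by
  have hlim := (tendsto_mul_tailMoment_div_normalizer hX hinf hDA hc).div_const c
  rw [zero_div] at hlim
  refine squeeze_zero (fun n => by positivity) (fun n => ?_) hlim
  have hD := normalizer_pos hX n
  rw [div_div, le_div_iff₀ (by positivity)]
  calc n * μ.real {ω | c * normalizer μ X n < |X ω|} * (normalizer μ X n * c)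
      = n * (c * normalizer μ X n * μ.real {ω | c * normalizer μ X n < |X ω|}) := by ring
    _ ≤ n * tailMoment μ X (c * normalizer μ X n) := by
        gcongr
        exact mul_measureReal_lt_abs_le_tailMoment hX (by positivity)

end Normalizer

section WeakLaw

variable {Ω : Type*} {m : MeasurableSpace Ω} {μ : Measure Ω}

lemma sum_natAbs_sub_le {C : ℕ → ℝ} (hC : ∀ k, 0 ≤ C k) {s : Finset ℤ} {i : ℤ} {n : ℕ}
    (hs : ∀ j ∈ s, (j - i).natAbs < n) :
    ∑ j ∈ s, C (j - i).natAbs ≤ 2 * ∑ k ∈ Finset.range n, C k := by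
  have hcard (k : ℕ) : (s.filter fun j => (j - i).natAbs = k).card ≤ 2 := by
    have hsub : (s.filter fun j => (j - i).natAbs = k) ⊆ {i + k, i - k} := fun j hj => by
      simp only [Finset.mem_filter, Finset.mem_insert, Finset.mem_singleton] at hj ⊢
      lia
    exact (Finset.card_le_card hsub).trans Finset.card_le_two
  rw [← Finset.sum_fiberwise_of_maps_to fun j hj => Finset.mem_range.2 (hs j hj), Finset.mul_sum]
  refine Finset.sum_le_sum fun k _ => ?_
  calc ∑ j ∈ s with (j - i).natAbs = k, C (j - i).natAbs
      = (s.filter fun j => (j - i).natAbs = k).card • C k :=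
        Finset.sum_eq_card_nsmul fun j hj => by rw [(Finset.mem_filter.1 hj).2]
    _ ≤ 2 • C k := nsmul_le_nsmul_left (hC k) (hcard k)
    _ = 2 * C k := by rw [nsmul_eq_mul, Nat.cast_ofNat]

lemma variance_sum_Icc_le [IsFiniteMeasure μ] {Z : ℤ → Ω → ℝ} (hZ : ∀ k, MemLp (Z k) 2 μ)
    {C : ℕ → ℝ} (hC : ∀ k, 0 ≤ C k)
    (hcov : ∀ (j : ℤ) (k : ℕ), cov[Z j, Z (j + k); μ] ≤ C k) (n : ℕ) :
    Var[fun ω => ∑ k ∈ Finset.Icc (1 : ℤ) n, Z k ω; μ] ≤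
      n * (2 * ∑ k ∈ Finset.range n, C k) := by
  have hcov_natAbs (i j : ℤ) : cov[Z i, Z j; μ] ≤ C (j - i).natAbs := by
    rcases le_total i j with hij | hij
    · simpa only [Int.natCast_natAbs, abs_of_nonneg (sub_nonneg.2 hij), add_sub_cancel] using
        hcov i (j - i).natAbs
    · rw [covariance_comm]
      simpa only [Int.natCast_natAbs, abs_of_nonpos (sub_nonpos.2 hij), neg_sub,
        add_sub_cancel] using hcov j (j - i).natAbs
  have hrow : ∀ i ∈ Finset.Icc (1 : ℤ) n,
      ∑ j ∈ Finset.Icc (1 : ℤ) n, cov[Z i, Z j; μ] ≤ 2 * ∑ k ∈ Finset.range n, C k := by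
    refine fun i hi => (Finset.sum_le_sum fun j _ => hcov_natAbs i j).trans
      (sum_natAbs_sub_le hC fun j hj => ?_)
    simp only [Finset.mem_Icc] at hi hj
    lia
  rw [variance_fun_sum' fun k _ => hZ k]
  simpa only [Int.card_Icc, add_sub_cancel_right, Int.toNat_natCast, nsmul_eq_mul] using
    Finset.sum_le_card_nsmul _ _ _ hrow

lemma tendstoInMeasure_of_forall_exists_variance_le [IsFiniteMeasure μ] {ι : Type*}
    {l : Filter ι} {Y : ι → Ω → ℝ} {c : ℝ}
    (h : ∀ ε, 0 < ε → ∃ Z : ι → Ω → ℝ, (∀ i, MemLp (Z i) 2 μ) ∧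
      Tendsto (fun i => μ.real {ω | Y i ω ≠ Z i ω}) l (𝓝 0) ∧
      Tendsto (fun i => ∫ ω, Z i ω ∂μ) l (𝓝 c) ∧ ∀ᶠ i in l, Var[Z i; μ] ≤ ε) :
    TendstoInMeasure μ Y l fun _ => c := by
  rw [tendstoInMeasure_iff_measureReal_norm]
  refine fun δ hδ => tendsto_order.2
    ⟨fun γ hγ => .of_forall fun i => hγ.trans_le measureReal_nonneg, fun γ hγ => ?_⟩
  obtain ⟨Z, hZ, hne, hmean, hvar⟩ := h (γ / 2 * (δ / 2) ^ 2) (by positivity)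
  filter_upwards [hne.eventually_lt_const (half_pos hγ), hvar,
    hmean.eventually (Metric.ball_mem_nhds c (half_pos hδ))] with i hne_i hvar_i hmean_i
  have hsub : {ω | δ ≤ ‖Y i ω - c‖} ⊆
      {ω | Y i ω ≠ Z i ω} ∪ {ω | δ / 2 ≤ |Z i ω - ∫ ω', Z i ω' ∂μ|} := by
    intro ω (hω : δ ≤ ‖Y i ω - c‖)
    by_cases hYZ : Y i ω = Z i ω
    · have htriangle := norm_sub_le_norm_sub_add_norm_sub (Z i ω) (∫ ω', Z i ω' ∂μ) c
      rw [dist_eq_norm] at hmean_i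
      rw [hYZ] at hω
      exact Or.inr (by simp only [Set.mem_ofPred_eq, ← Real.norm_eq_abs]; linarith)
    · exact Or.inl hYZ
  have hchebyshev : μ.real {ω | δ / 2 ≤ |Z i ω - ∫ ω', Z i ω' ∂μ|} ≤ γ / 2 :=
    calc _ ≤ Var[Z i; μ] / (δ / 2) ^ 2 :=
          ENNReal.toReal_le_of_le_ofReal (div_nonneg (variance_nonneg _ _) (sq_nonneg _))
            (meas_ge_le_variance_div_sq (hZ i) (half_pos hδ))
      _ ≤ γ / 2 := (div_le_iff₀ (by positivity)).2 hvar_i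
  calc μ.real {ω | δ ≤ ‖Y i ω - c‖}
      ≤ μ.real {ω | Y i ω ≠ Z i ω} + μ.real {ω | δ / 2 ≤ |Z i ω - ∫ ω', Z i ω' ∂μ|} :=
        (measureReal_mono hsub).trans (measureReal_union_le _ _)
    _ < γ := by linarith

end WeakLaw

section Mixing

variable {Ω : Type*} {m : MeasurableSpace Ω} {μ : Measure Ω} {ξ : ℤ → Ω → ℝ}
  [IsFiniteMeasure μ]

lemma measureReal_sum_sq_ne_sum_truncSq_le (hident : ∀ k, IdentDistrib (ξ k) (ξ 0) μ μ) (n : ℕ)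
    (a : ℝ) :
    μ.real {ω | ∑ k ∈ Finset.Icc (1 : ℤ) n, ξ k ω ^ 2 ≠
        ∑ k ∈ Finset.Icc (1 : ℤ) n, truncSq (ξ k) a ω} ≤
      n * μ.real {ω | a < |ξ 0 ω|} := by
  have hset : MeasurableSet {x : ℝ | a < |x|} :=
    measurableSet_lt measurable_const measurable_id.abs
  have hprob (k : ℤ) : μ.real {ω | a < |ξ k ω|} = μ.real {ω | a < |ξ 0 ω|} :=
    congrArg ENNReal.toReal ((hident k).measure_mem_eq hset)
  have hsub : {ω | ∑ k ∈ Finset.Icc (1 : ℤ) n, ξ k ω ^ 2 ≠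
      ∑ k ∈ Finset.Icc (1 : ℤ) n, truncSq (ξ k) a ω} ⊆
      ⋃ k ∈ Finset.Icc (1 : ℤ) n, {ω | a < |ξ k ω|} := fun ω hω => by
    contrapose! hω
    simp only [Set.mem_iUnion, Set.mem_ofPred_eq, not_exists, not_lt] at hω
    exact not_not.2 (Finset.sum_congr rfl fun k hk => by rw [truncSq_apply, if_pos (hω k hk)])
  refine (measureReal_mono hsub (measure_ne_top _ _)).trans
    ((measureReal_biUnion_finset_le _ _).trans_eq ?_)
  simp only [hprob, Finset.sum_const, Int.card_Icc, add_sub_cancel_right, Int.toNat_natCast,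
    nsmul_eq_mul]

lemma integral_sum_truncSq (hident : ∀ k, IdentDistrib (ξ k) (ξ 0) μ μ) (n : ℕ) (a : ℝ) :
    ∫ ω, ∑ k ∈ Finset.Icc (1 : ℤ) n, truncSq (ξ k) a ω ∂μ = n * truncMoment μ (ξ 0) a := by
  rw [integral_finsetSum _ fun k _ => integrable_truncSq (hident k).aemeasurable_fst a]
  have hmean (k : ℤ) : ∫ ω, truncSq (ξ k) a ω ∂μ = truncMoment μ (ξ 0) a :=
    congrFun (truncMoment_eq_of_identDistrib (hident k)) a
  simp only [hmean, Finset.sum_const, Int.card_Icc, add_sub_cancel_right, Int.toNat_natCast,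
    nsmul_eq_mul]

lemma variance_sum_truncSq_le (hmeas : ∀ k, AEMeasurable (ξ k) μ) {φ ψ : ℕ → ℝ}
    (hφ : ∀ k, 0 ≤ φ k) (hψ : ∀ k, 0 ≤ ψ k) {a h : ℝ} (hh : 0 ≤ h)
    (hcov : ∀ (j : ℤ) (k : ℕ),
      cov[truncSq (ξ j) a, truncSq (ξ (j + k)) a; μ] ≤ a ^ 2 * h * φ k + h ^ 2 * ψ k)
    (n : ℕ) :
    Var[fun ω => ∑ k ∈ Finset.Icc (1 : ℤ) n, truncSq (ξ k) a ω; μ] ≤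
      2 * a ^ 2 * (∑ k ∈ Finset.range n, φ k) * (n * h) +
        2 * (n * h) ^ 2 * ((n : ℝ)⁻¹ * ∑ k ∈ Finset.range n, ψ k) := by
  refine (variance_sum_Icc_le (fun k => memLp_truncSq (hmeas k) a 2)
    (fun k => add_nonneg (mul_nonneg (by positivity) (hφ k)) (mul_nonneg (by positivity) (hψ k)))
    hcov n).trans_eq ?_
  rw [Finset.sum_add_distrib, ← Finset.mul_sum, ← Finset.mul_sum]
  rcases eq_or_ne (n : ℝ) 0 with hn | hn
  · simp [hn]
  · field_simp

end Mixing

section CovarianceDecay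

variable {Ω : Type*} {m : MeasurableSpace Ω} {μ : Measure Ω} {ξ : ℤ → Ω → ℝ}

/-- The common consequence of `(M₁)` and `(M₂)` from which the weak law for the squares is derived.
Unlike in these conditions, the two truncation levels agree and the lag `k = 0` is allowed. -/
def CovarianceDecay {Ω : Type*} [MeasurableSpace Ω] (μ : Measure Ω) (ξ : ℤ → Ω → ℝ) : Prop :=
  ∃ φ ψ : ℕ → ℝ, (∀ k, 0 ≤ φ k) ∧ (∀ k, 0 ≤ ψ k) ∧ Summable φ ∧ Tendsto ψ atTop (𝓝 0) ∧
    ∀ a : ℝ, 0 < a → ∀ (j : ℤ) (k : ℕ),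
      cov[truncSq (ξ j) a, truncSq (ξ (j + k)) a; μ] ≤
        a ^ 2 * truncMoment μ (ξ 0) a * φ k + truncMoment μ (ξ 0) a ^ 2 * ψ k

section OfMixing

variable [IsProbabilityMeasure μ]

lemma covariance_truncSq_self_le {X : Ω → ℝ} (hX : AEMeasurable X μ) (a : ℝ) :
    cov[truncSq X a, truncSq X a; μ] ≤ a ^ 2 * truncMoment μ X a := by
  have hL2 := memLp_truncSq hX a 2
  calc cov[truncSq X a, truncSq X a; μ]
      = Var[truncSq X a; μ] := covariance_self hL2.aemeasurable
    _ ≤ ∫ ω, truncSq X a ω ^ 2 ∂μ := variance_le_expectation_sq hL2.aestronglyMeasurable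
    _ ≤ ∫ ω, a ^ 2 * truncSq X a ω ∂μ := by
        refine integral_mono hL2.integrable_sq ((integrable_truncSq hX a).const_mul _) fun ω => ?_
        simp only [sq (truncSq X a ω)]
        exact mul_le_mul_of_nonneg_right (truncSq_le_sq X a ω) (truncSq_nonneg X a ω)
    _ = a ^ 2 * truncMoment μ X a := integral_const_mul _ _

lemma covarianceDecay_of_forall_one_le (hident : ∀ k, IdentDistrib (ξ k) (ξ 0) μ μ)
    {φ ψ : ℕ → ℝ} (hφ : ∀ k, 0 ≤ φ k) (hψ : ∀ k, 0 ≤ ψ k) (hφ_sum : Summable φ)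
    (hψ_lim : Tendsto ψ atTop (𝓝 0))
    (hcov : ∀ a : ℝ, 0 < a → ∀ (j : ℤ) (k : ℕ), 1 ≤ k →
      cov[truncSq (ξ j) a, truncSq (ξ (j + k)) a; μ] ≤
        a ^ 2 * truncMoment μ (ξ 0) a * φ k + truncMoment μ (ξ 0) a ^ 2 * ψ k) :
    CovarianceDecay μ ξ := by
  refine ⟨fun k => φ k + if k = 0 then 1 else 0, ψ, fun k => ?_, hψ,
    hφ_sum.add (hasSum_ite_eq 0 1).summable, hψ_lim, fun a ha j k => ?_⟩
  · exact add_nonneg (hφ k) (by split_ifs <;> norm_num)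
  rcases Nat.eq_zero_or_pos k with rfl | hk
  · have hself := covariance_truncSq_self_le (hident j).aemeasurable_fst a
    rw [truncMoment_eq_of_identDistrib (hident j)] at hself
    have hφ0 : 0 ≤ a ^ 2 * truncMoment μ (ξ 0) a * φ 0 :=
      mul_nonneg (mul_nonneg (sq_nonneg a) (truncMoment_nonneg _ a)) (hφ 0)
    have hψ0 : 0 ≤ truncMoment μ (ξ 0) a ^ 2 * ψ 0 := mul_nonneg (sq_nonneg _) (hψ 0)
    simp only [Nat.cast_zero, add_zero, if_true]
    linarith
  · simpa only [hk.ne', if_false, add_zero] using hcov a ha j k hk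

lemma covarianceDecay_of_mixingOne (hident : ∀ k, IdentDistrib (ξ k) (ξ 0) μ μ)
    (h : MixingOne μ ξ) : CovarianceDecay μ ξ := by
  obtain ⟨ψ, hψ, hψ_lim, hcov⟩ := h
  refine covarianceDecay_of_forall_one_le hident (φ := 0) (fun _ => le_rfl) (fun k => (hψ k).le)
    summable_zero hψ_lim fun a ha j k hk => (hcov a a ha ha j k hk).trans_eq ?_
  rw [Pi.zero_apply]
  ring

lemma covarianceDecay_of_mixingTwo (hident : ∀ k, IdentDistrib (ξ k) (ξ 0) μ μ)
    (h : MixingTwo μ ξ) : CovarianceDecay μ ξ := by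
  obtain ⟨φ, hφ, hφ_sum, hcov⟩ := h
  refine covarianceDecay_of_forall_one_le hident (ψ := 0) (fun k => (hφ k).le) (fun _ => le_rfl)
    hφ_sum tendsto_const_nhds fun a ha j k hk => (hcov a a ha ha j k hk).trans_eq ?_
  rw [Pi.zero_apply]
  ring

end OfMixing

variable [IsFiniteMeasure μ]

/- At the level `θ D_n`, where `n H(θ D_n) ~ D_n²`, the variance is at most
`(2θ² ∑ φ + o(1)) D_n⁴`. -/
lemma CovarianceDecay.exists_eventually_variance_le (h : CovarianceDecay μ ξ)
    (hident : ∀ k, IdentDistrib (ξ k) (ξ 0) μ μ) (hint : Integrable (ξ 0) μ)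
    (hinf : ∫⁻ ω, ENNReal.ofReal (ξ 0 ω ^ 2) ∂μ = ⊤) (hDA : SlowlyVarying (truncMoment μ (ξ 0)))
    {ε : ℝ} (hε : 0 < ε) :
    ∃ θ > 0, ∀ᶠ n : ℕ in atTop, Var[fun ω => 1 / normalizer μ (ξ 0) n ^ 2 *
      ∑ k ∈ Finset.Icc (1 : ℤ) n, truncSq (ξ k) (θ * normalizer μ (ξ 0) n) ω; μ] ≤ ε := by
  obtain ⟨φ, ψ, hφ, hψ, hφ_sum, hψ_lim, hcov⟩ := h
  have hΦ : 0 ≤ ∑' k, φ k := tsum_nonneg hφ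
  obtain ⟨θ, hθ, hθε⟩ : ∃ θ > 0, 2 * θ ^ 2 * ∑' k, φ k < ε := by
    refine ⟨√(ε / (2 * ∑' k, φ k + 1)), by positivity, ?_⟩
    rw [Real.sq_sqrt (by positivity), mul_assoc, mul_left_comm, div_mul_eq_mul_div,
      div_lt_iff₀ (by positivity)]
    linarith
  let u : ℕ → ℝ := fun n =>
    n * truncMoment μ (ξ 0) (θ * normalizer μ (ξ 0) n) / normalizer μ (ξ 0) n ^ 2
  have hu : Tendsto u atTop (𝓝 1) := tendsto_mul_truncMoment_div_normalizer_sq hint hinf hDA hθ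
  have hlim : Tendsto (fun n : ℕ => 2 * θ ^ 2 * (∑ k ∈ Finset.range n, φ k) * u n +
      2 * u n ^ 2 * ((n : ℝ)⁻¹ * ∑ k ∈ Finset.range n, ψ k)) atTop
      (𝓝 (2 * θ ^ 2 * ∑' k, φ k)) := by
    simpa only [mul_one, mul_zero, add_zero] using
      ((hφ_sum.hasSum.tendsto_sum_nat.const_mul (2 * θ ^ 2)).mul hu).add
        (((hu.pow 2).const_mul 2).mul hψ_lim.cesaro)
  refine ⟨θ, hθ, ?_⟩
  filter_upwards [hlim.eventually_le_const hθε] with n hn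
  have hD := normalizer_pos hint n
  have hsum := variance_sum_truncSq_le (fun k => (hident k).aemeasurable_fst) hφ hψ
    (truncMoment_nonneg _ _) (hcov _ (mul_pos hθ hD)) n
  rw [variance_const_mul]
  refine (mul_le_mul_of_nonneg_left hsum (by positivity)).trans (le_of_eq_of_le ?_ hn)
  simp only [u]
  field_simp

theorem CovarianceDecay.squaresConverge (h : CovarianceDecay μ ξ)
    (hident : ∀ k, IdentDistrib (ξ k) (ξ 0) μ μ) (hint : Integrable (ξ 0) μ)
    (hinf : ∫⁻ ω, ENNReal.ofReal (ξ 0 ω ^ 2) ∂μ = ⊤)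
    (hDA : SlowlyVarying (truncMoment μ (ξ 0))) : SquaresConverge μ ξ := by
  refine tendstoInMeasure_of_forall_exists_variance_le fun ε hε => ?_
  obtain ⟨θ, hθ, hvar⟩ := h.exists_eventually_variance_le hident hint hinf hDA hε
  refine ⟨_, fun n => ?_, ?_, ?_, hvar⟩
  · exact (memLp_finsetSum _ fun k _ =>
      memLp_truncSq (hident k).aemeasurable_fst _ 2).const_mul _
  · refine squeeze_zero (fun n => measureReal_nonneg) (fun n => ?_)
      (tendsto_mul_measureReal_lt_abs hint hinf hDA hθ)
    refine le_trans (measureReal_mono ?_) (measureReal_sum_sq_ne_sum_truncSq_le hident n _)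
    exact fun ω hω heq => hω (congrArg _ heq)
  · refine (tendsto_mul_truncMoment_div_normalizer_sq hint hinf hDA hθ).congr fun n => ?_
    rw [integral_const_mul, integral_sum_truncSq hident, one_div_mul_eq_div]

end CovarianceDecay

section CentralLimit

variable {Ω : Type*} {m : MeasurableSpace Ω} {μ : Measure Ω} {ξ : ℤ → Ω → ℝ}

lemma tendsto_sum_tailMoment_inv_normalizer_mul [IsFiniteMeasure μ]
    (hident : ∀ k, IdentDistrib (ξ k) (ξ 0) μ μ) (hint : Integrable (ξ 0) μ)
    (hinf : ∫⁻ ω, ENNReal.ofReal (ξ 0 ω ^ 2) ∂μ = ⊤)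
    (hDA : SlowlyVarying (truncMoment μ (ξ 0))) {a : ℝ} (ha : 0 < a) :
    Tendsto (fun n : ℕ => ∑ k ∈ Finset.Icc (1 : ℤ) n,
      tailMoment μ (fun ω => (normalizer μ (ξ 0) n)⁻¹ * ξ k ω) a) atTop (𝓝 0) := by
  refine (tendsto_mul_tailMoment_div_normalizer hint hinf hDA ha).congr fun n => ?_
  have hD := normalizer_pos hint n
  simp only [tailMoment_const_mul _ (inv_ne_zero hD.ne'), abs_of_pos (inv_pos.2 hD), div_inv_eq_mul,
    tailMoment_eq_of_identDistrib (hident _), Finset.sum_const, Int.card_Icc, add_sub_cancel_right,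
    Int.toNat_natCast, nsmul_eq_mul]
  ring

theorem IsMartingaleDifference.tendstoInDistribution_of_squaresConverge [IsProbabilityMeasure μ]
    {ℱ : Filtration ℤ m} (hmart : IsMartingaleDifference μ ℱ ξ)
    (hident : ∀ k, IdentDistrib (ξ k) (ξ 0) μ μ)
    (hinf : ∫⁻ ω, ENNReal.ofReal (ξ 0 ω ^ 2) ∂μ = ⊤)
    (hDA : SlowlyVarying (truncMoment μ (ξ 0))) (hsq : SquaresConverge μ ξ) :
    TendstoInDistribution
      (fun (n : ℕ) ω => (∑ k ∈ Finset.Icc (1 : ℤ) n, ξ k ω) / normalizer μ (ξ 0) n)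
      atTop (id : ℝ → ℝ) (fun _ => μ) (gaussianReal 0 1) := by
  have hsq_scaled : TendstoInMeasure μ (fun (n : ℕ) ω => ∑ k ∈ Finset.Icc (1 : ℤ) n,
      ((normalizer μ (ξ 0) n)⁻¹ * ξ k ω) ^ 2) atTop (fun _ => ((1 : NNReal) : ℝ)) := by
    simpa only [SquaresConverge, mul_pow, inv_pow, one_div, Finset.mul_sum, NNReal.coe_one]
      using hsq
  simpa only [div_eq_inv_mul, Finset.mul_sum] using
    tendstoInDistribution_gaussianReal_of_tendsto_sum_tailMoment
      (fun n : ℕ => hmart.const_mul (normalizer μ (ξ 0) n)⁻¹)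
      (fun _ => tendsto_sum_tailMoment_inv_normalizer_mul hident (hmart.integrable 0) hinf hDA)
      hsq_scaled

end CentralLimit

end InfVarMart

theorem mainTheorem10 {Ω : Type*} {m : MeasurableSpace Ω} (μ : Measure Ω)
    [IsProbabilityMeasure μ] (ℱ : Filtration ℤ m) (ξ : ℤ → Ω → ℝ)
    (hmart : InfVarMart.IsMartingaleDifference μ ℱ ξ)
    (hident : ∀ k, IdentDistrib (ξ k) (ξ 0) μ μ)
    (hinf : ∫⁻ ω, ENNReal.ofReal (ξ 0 ω ^ 2) ∂μ = ⊤)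
    (hDA : InfVarMart.SlowlyVarying (InfVarMart.truncMoment μ (ξ 0))) :
    (InfVarMart.SquaresConverge μ ξ →
      TendstoInDistribution
        (fun (n : ℕ) ω =>
          (∑ k ∈ Finset.Icc (1 : ℤ) n, ξ k ω) / InfVarMart.normalizer μ (ξ 0) n)
        atTop (id : ℝ → ℝ) (fun _ => μ) (gaussianReal 0 1)) ∧
    (InfVarMart.MixingOne μ ξ ∨ InfVarMart.MixingTwo μ ξ → InfVarMart.SquaresConverge μ ξ) := by
  have hint : Integrable (ξ 0) μ := hmart.integrable 0
  refine ⟨hmart.tendstoInDistribution_of_squaresConverge hident hinf hDA, ?_⟩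
  rintro (hM₁ | hM₂)
  · exact (InfVarMart.covarianceDecay_of_mixingOne hident hM₁).squaresConverge hident hint hinf hDA
  · exact (InfVarMart.covarianceDecay_of_mixingTwo hident hM₂).squaresConverge hident hint hinf hDA
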